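/- Let $B$ be a Banach algebra over $\mathbb K=\mathbb R$ or $\mathbb C$ (not necessarily unital or commutative). A Banach $B$-bimodule is a Banach space $X$ with jointly bounded bilinear, associative left and right actions of $B$ that commute with each other; its dual $X^*$ is a Banach $B$-bimodule under $(b.f)(x)=f(x.b)$, $(f.b)(x)=f(b.x)$. A Banach algebra $B$ is *amenable* if for every Banach $B$-bimodule $X$ the first bounded Hochschild cohomology group $H^1(B,X^*)$ vanishes, i.e. every bounded linear map $D\colon B\to X^*$ with $D(ab)=a.D(b)+D(a).b$ for all $a,b\in B$ is of the form $D(a)=a.f-f.a$ for some $f\in X^*$. A *bounded approximate identity* of a Banach algebra $A$ is a norm-bounded net $(e_\gamma)$ in $A$ with $e_\gamma a\to a$ and $ae_\gamma\to a$ in norm for all $a\in A$. **Theorem 2.1.** Let $B$ be an amenable Banach algebra and let $A\subseteq B$ be a closed two-sided ideal (in particular a linear subspace). Then $A$, with the norm inherited from $B$, is amenable if and only if $A$ has a bounded approximate identity. -/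

import Mathlib

universe u v

/-- A (non-unital) subalgebra of a normed algebra is a normed space for the restricted norm. -/
instance NonUnitalSubalgebra.instNormedSpaceRestrict {𝕜 : Type} [RCLike 𝕜] {B : Type u}
    [NonUnitalNormedRing B] [NormedSpace 𝕜 B] (A : NonUnitalSubalgebra 𝕜 B) :
    NormedSpace 𝕜 A where
  norm_smul_le c a := norm_smul_le c (a : B)

/-- A Banach `A`-bimodule structure on the normed space `X` (completeness of `X` is required
where the notion is used): jointly bounded bilinear left and right actions
`lact a x = a.x` and `ract a x = x.a`, each associative, that commute with each other.
The algebra `A` need not have a unit. -/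
structure BanachBimodule (𝕜 : Type) [RCLike 𝕜] (A : Type u) [NonUnitalNormedRing A]
    [NormedSpace 𝕜 A] (X : Type v) [NormedAddCommGroup X] [NormedSpace 𝕜 X] where
  /-- the left action, `lact a x = a.x` -/
  lact : A →L[𝕜] X →L[𝕜] X
  /-- the right action, `ract a x = x.a` -/
  ract : A →L[𝕜] X →L[𝕜] X
  lact_mul : ∀ (a b : A) (x : X), lact (a * b) x = lact a (lact b x)
  ract_mul : ∀ (a b : A) (x : X), ract (a * b) x = ract b (ract a x)
  lact_ract : ∀ (a b : A) (x : X), lact a (ract b x) = ract b (lact a x)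

namespace BanachBimodule

section

variable {𝕜 : Type} [RCLike 𝕜] {A : Type u} [NonUnitalNormedRing A] [NormedSpace 𝕜 A]
  {X : Type v} [NormedAddCommGroup X] [NormedSpace 𝕜 X]

/-- The dual bimodule `X*`: `(a.f)(x) = f(x.a)` and `(f.a)(x) = f(a.x)`. -/
noncomputable def dual (M : BanachBimodule 𝕜 A X) : BanachBimodule 𝕜 A (StrongDual 𝕜 X) where
  lact := (ContinuousLinearMap.compL 𝕜 X X 𝕜).flip.comp M.ract
  ract := (ContinuousLinearMap.compL 𝕜 X X 𝕜).flip.comp M.lact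
  lact_mul a b f := by ext x; simp [M.ract_mul]
  ract_mul a b f := by ext x; simp [M.lact_mul]
  lact_ract a b f := by ext x; simp [M.lact_ract]

theorem dual_lact_apply (M : BanachBimodule 𝕜 A X) (a : A) (f : StrongDual 𝕜 X) (x : X) :
    M.dual.lact a f x = f (M.ract a x) := rfl

theorem dual_ract_apply (M : BanachBimodule 𝕜 A X) (a : A) (f : StrongDual 𝕜 X) (x : X) :
    M.dual.ract a f x = f (M.lact a x) := rfl

/-- The space `Z¹(A, X)` of bounded derivations `D : A → X`, `D(ab) = a.D(b) + D(a).b`. -/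
def derivations (M : BanachBimodule 𝕜 A X) : Submodule 𝕜 (A →L[𝕜] X) where
  carrier := {D | ∀ a b : A, D (a * b) = M.lact a (D b) + M.ract b (D a)}
  add_mem' {D E} hD hE a b := by
    simp only [_root_.add_apply, map_add, hD a b, hE a b]
    abel
  zero_mem' a b := by simp
  smul_mem' c D hD a b := by
    simp only [_root_.smul_apply, map_smul, hD a b, smul_add]

/-- The space `B¹(A, X)` of inner derivations `a ↦ a.x - x.a`, `x ∈ X`, inside `Z¹(A, X)`. -/
def innerDerivations (M : BanachBimodule 𝕜 A X) : Submodule 𝕜 M.derivations where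
  carrier := {D | ∃ x : X, ∀ a : A, D.1 a = M.lact a x - M.ract a x}
  add_mem' := by
    rintro D E ⟨x, hx⟩ ⟨y, hy⟩
    refine ⟨x + y, fun a => ?_⟩
    simp only [Submodule.coe_add, _root_.add_apply, hx a, hy a, map_add]
    abel
  zero_mem' := ⟨0, fun a => by simp⟩
  smul_mem' := by
    rintro c D ⟨x, hx⟩
    refine ⟨c • x, fun a => ?_⟩
    simp only [Submodule.coe_smul, _root_.smul_apply, hx a, map_smul, smul_sub]

/-- The first bounded Hochschild cohomology group `H¹(A, X) = Z¹(A, X) / B¹(A, X)`. -/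
abbrev H1 (M : BanachBimodule 𝕜 A X) : Type (max u v) :=
  M.derivations ⧸ M.innerDerivations

end

end BanachBimodule

/-- `A` is amenable if `H¹(A, X*) = {0}` for all Banach `A`-bimodules `X`. -/
def IsAmenableBanachAlgebra (𝕜 : Type) [RCLike 𝕜] (A : Type u) [NonUnitalNormedRing A]
    [NormedSpace 𝕜 A] : Prop :=
  ∀ (X : Type u) [NormedAddCommGroup X] [NormedSpace 𝕜 X] [CompleteSpace X]
    (M : BanachBimodule 𝕜 A X), Subsingleton M.dual.H1

/-- `A` has a bounded (two-sided) approximate identity: a norm-bounded net `(e_γ)` in `A` with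
`a e_γ → a` and `e_γ a → a` for all `a`, where nets are expressed as proper filters on `A`
(a net gives the filter of its tails; a proper filter comes from a net, and a bound that holds
eventually can be made to hold everywhere by passing to a tail). -/
def HasBoundedApproximateIdentity (A : Type u) [NonUnitalNormedRing A] : Prop :=
  ∃ l : Filter A, l.IsApproximateUnit ∧ ∃ C : ℝ, ∀ᶠ e in l, ‖e‖ ≤ C

/-! If `A` is amenable, let it act on `A*` from one side and by zero from the other. The embedding
`A → A**` is then a derivation, and its primitive is a one-sided identity of `A**`. A Hahn-Banach
argument brings it down to bounded elements of `A`, and `e + f - f * e` merges the two sides.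
Conversely, a bounded approximate identity has a weak* limit `e` in the bidual (a mixed identity),
and amenability of `B` gives a virtual diagonal `M`. Bilinear forms on `A` are pulled back to `B` by
`F ↦ F(p·, ·q)` with `p, q ∈ A`, which uses the ideal property. Applying `M` and then letting `q`
and `p` run along `e` gives a virtual diagonal of `A` (`IsVirtualDiagonal.exists_of_ideal`).
Averaging derivations against it proves amenability (`IsVirtualDiagonal.isAmenable`). -/

open ContinuousLinearMap Filter Topology

/-! ### Amenability yields a bounded approximate identity. -/

section BoundedApproximateIdentity

variable {𝕜 : Type} [RCLike 𝕜] {A : Type u}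

/-- Goldstine-type approximation: if an element `E` of the bidual is a weak identity for the
operators `T a`, then a bounded set of elements of `A` approximates this behaviour in norm,
simultaneously on finite sets. -/
theorem exists_bounded_approx_of_bidual [NormedAddCommGroup A] [NormedSpace 𝕜 A]
    (T : A → A →L[𝕜] A) (E : StrongDual 𝕜 (StrongDual 𝕜 A))
    (hE : ∀ (a : A) (φ : StrongDual 𝕜 A), E (φ ∘L T a) = φ a)
    (F : Finset A) {ε : ℝ} (hε : 0 < ε) :
    ∃ e : A, ‖e‖ ≤ ‖E‖ + 1 ∧ ∀ a ∈ F, ‖T a e - a‖ < ε := by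
  classical
  let _ : NormedSpace ℝ A := NormedSpace.restrictScalars ℝ 𝕜 A
  have : IsScalarTower ℝ 𝕜 A := RestrictScalars.isScalarTower ℝ 𝕜 A
  let Φ : A →L[𝕜] (F → A) := ContinuousLinearMap.pi fun a => T a
  let p : F → A := fun a => a
  let S : Set (F → A) := (fun e => Φ e - p) '' Metric.closedBall 0 (‖E‖ + 1)
  have hS : Convex ℝ S := by
    have h : S = (fun y => -p + y) '' ((Φ.restrictScalars ℝ).toLinearMap ''
        Metric.closedBall 0 (‖E‖ + 1)) := by
      simp only [S, Set.image_image]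
      refine Set.image_congr fun e _ => ?_
      simp [sub_eq_neg_add]
    rw [h]
    exact ((convex_closedBall 0 _).linear_image _).translate _
  by_cases h0 : (0 : F → A) ∈ closure S
  · obtain ⟨_, ⟨e, he, rfl⟩, hd⟩ := Metric.mem_closure_iff.1 h0 ε hε
    refine ⟨e, by simpa using he, fun a ha => ?_⟩
    rw [dist_zero_left] at hd
    exact (norm_le_pi_norm (Φ e - p) ⟨a, ha⟩).trans_lt hd
  · exfalso
    obtain ⟨f, u, hu, hf⟩ := RCLike.geometric_hahn_banach_point_closed (𝕜 := 𝕜)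
      hS.closure isClosed_closure h0
    simp only [map_zero] at hu
    have hEf : E (f ∘L Φ) = f p := by
      have h1 : f ∘L Φ = ∑ a : F, (f ∘L ContinuousLinearMap.single 𝕜 (fun _ : F => A) a) ∘L T a := by
        ext e
        have := ContinuousLinearMap.sum_comp_single 𝕜 _ f (Φ e)
        simpa [Φ] using this.symm
      rw [h1, map_sum]
      simp only [hE]
      exact ContinuousLinearMap.sum_comp_single 𝕜 _ f p
    -- Rotating `e` by a unimodular scalar turns the separation bound on `re f` into a norm bound on
    -- `f ∘L Φ`. Then `‖f p‖ = ‖E (f ∘L Φ)‖ ≤ -u - re (f p)`, impossible for `u > 0`. The `+ 1`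
    -- keeps the radius positive when `E = 0`.
    have hball : ∀ e ∈ Metric.closedBall (0 : A) (‖E‖ + 1),
        ‖(f ∘L Φ) e‖ ≤ -u - RCLike.re (f p) := by
      intro e he
      obtain ⟨c, hc, hce⟩ := RCLike.exists_norm_eq_mul_self ((f ∘L Φ) e)
      have h2 := hf _ (subset_closure ⟨-(c • e), by simpa [norm_smul, hc] using he, rfl⟩)
      have h3 : f (Φ (-(c • e)) - p) = -((‖(f ∘L Φ) e‖ : ℝ) : 𝕜) - f p := by
        rw [hce]; simp
      rw [h3] at h2
      simp only [map_sub, map_neg, RCLike.ofReal_re] at h2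
      linarith
    have hpos : 0 < ‖E‖ + 1 := by positivity
    have hr : 0 ≤ -u - RCLike.re (f p) :=
      (norm_nonneg _).trans (hball 0 (by simpa using hpos.le))
    have hg := ContinuousLinearMap.opNorm_bound_of_ball_bound hpos _ (f ∘L Φ) hball
    have hle : ‖f p‖ ≤ -u - RCLike.re (f p) := by
      rw [← hEf] at hr ⊢
      refine (E.le_opNorm _).trans ?_
      refine (mul_le_mul_of_nonneg_left hg (norm_nonneg _)).trans ?_
      rw [hEf] at hr ⊢
      rw [mul_div_assoc', div_le_iff₀ hpos]
      nlinarith [norm_nonneg E]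
    have := RCLike.abs_re_le_norm (f p)
    have := neg_abs_le (RCLike.re (f p))
    linarith [map_zero (RCLike.re (K := 𝕜))]

theorem hasBoundedApproximateIdentity_of_forall_finset [NonUnitalNormedRing A] (C : ℝ)
    (h : ∀ (F : Finset A) (ε : ℝ), 0 < ε →
      ∃ e : A, ‖e‖ ≤ C ∧ ∀ a ∈ F, ‖a * e - a‖ < ε ∧ ‖e * a - a‖ < ε) :
    HasBoundedApproximateIdentity A := by
  classical
  choose e he h' using fun i : Finset A × ℕ =>
    h i.1 (1 / ((i.2 : ℝ) + 1)) Nat.one_div_pos_of_nat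
  have key : ∀ (a : A) (ε : ℝ), 0 < ε → ∀ᶠ i in (atTop : Filter (Finset A × ℕ)),
      ‖a * e i - a‖ < ε ∧ ‖e i * a - a‖ < ε := by
    intro a ε hε
    obtain ⟨n, hn⟩ := exists_nat_one_div_lt hε
    filter_upwards [eventually_ge_atTop (({a} : Finset A), n)] with i hi
    have hlt : 1 / ((i.2 : ℝ) + 1) < ε :=
      (Nat.one_div_le_one_div hi.2).trans_lt hn
    have := h' i a (hi.1 (Finset.mem_singleton_self a))
    exact ⟨this.1.trans hlt, this.2.trans hlt⟩
  refine ⟨map e atTop, ⟨fun a => ?_, fun a => ?_⟩, C, ?_⟩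
  · refine tendsto_map'_iff.2 (Metric.tendsto_nhds.2 fun ε hε => ?_)
    filter_upwards [key a ε hε] with i hi
    simpa [dist_eq_norm] using hi.1
  · refine tendsto_map'_iff.2 (Metric.tendsto_nhds.2 fun ε hε => ?_)
    filter_upwards [key a ε hε] with i hi
    simpa [dist_eq_norm] using hi.2
  · exact eventually_map.2 (Eventually.of_forall he)

variable [NonUnitalNormedRing A] [NormedSpace 𝕜 A]

theorem exists_inner_of_isAmenable (hA : IsAmenableBanachAlgebra 𝕜 A)
    {X : Type u} [NormedAddCommGroup X] [NormedSpace 𝕜 X] [CompleteSpace X]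
    (M : BanachBimodule 𝕜 A X) (D : A →L[𝕜] StrongDual 𝕜 X)
    (hD : ∀ a b, D (a * b) = M.dual.lact a (D b) + M.dual.ract b (D a)) :
    ∃ f : StrongDual 𝕜 X, ∀ a, D a = M.dual.lact a f - M.dual.ract a f := by
  have := hA X M
  have h : Submodule.Quotient.mk (p := M.dual.innerDerivations) ⟨D, hD⟩ = 0 := Subsingleton.elim _ _
  exact (Submodule.Quotient.mk_eq_zero _).1 h

variable [IsScalarTower 𝕜 A A] [SMulCommClass 𝕜 A A]

variable (𝕜 A) in
/-- The dual of `A` with right action `(f.a)(x) = f(ax)` and zero left action. -/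
noncomputable def BanachBimodule.dualRightModule : BanachBimodule 𝕜 A (StrongDual 𝕜 A) where
  lact := 0
  ract := (compL 𝕜 A A 𝕜).flip ∘L ContinuousLinearMap.mul 𝕜 A
  lact_mul _ _ _ := rfl
  ract_mul a b f := by ext x; simp [mul_assoc]
  lact_ract _ _ _ := by simp

variable (𝕜 A) in
/-- The dual of `A` with left action `(a.f)(x) = f(xa)` and zero right action. -/
noncomputable def BanachBimodule.dualLeftModule : BanachBimodule 𝕜 A (StrongDual 𝕜 A) where
  lact := (compL 𝕜 A A 𝕜).flip ∘L (ContinuousLinearMap.mul 𝕜 A).flip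
  ract := 0
  lact_mul a b f := by ext x; simp [mul_assoc]
  ract_mul _ _ _ := rfl
  lact_ract _ _ _ := by simp

theorem IsAmenableBanachAlgebra.exists_bidual_right_identity
    (hA : IsAmenableBanachAlgebra 𝕜 A) :
    ∃ E : StrongDual 𝕜 (StrongDual 𝕜 A), ∀ (a : A) (φ : StrongDual 𝕜 A),
      E (φ ∘L ContinuousLinearMap.mul 𝕜 A a) = φ a := by
  obtain ⟨E, hE⟩ := exists_inner_of_isAmenable hA (BanachBimodule.dualRightModule 𝕜 A)
    (NormedSpace.inclusionInDoubleDual 𝕜 A) (fun a b => by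
      ext f
      simp [BanachBimodule.dual, BanachBimodule.dualRightModule])
  refine ⟨E, fun a φ => ?_⟩
  have := DFunLike.congr_fun (hE a) φ
  simpa [BanachBimodule.dual, BanachBimodule.dualRightModule] using this.symm

theorem IsAmenableBanachAlgebra.exists_bidual_left_identity
    (hA : IsAmenableBanachAlgebra 𝕜 A) :
    ∃ E : StrongDual 𝕜 (StrongDual 𝕜 A), ∀ (a : A) (φ : StrongDual 𝕜 A),
      E (φ ∘L (ContinuousLinearMap.mul 𝕜 A).flip a) = φ a := by
  obtain ⟨E, hE⟩ := exists_inner_of_isAmenable hA (BanachBimodule.dualLeftModule 𝕜 A)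
    (NormedSpace.inclusionInDoubleDual 𝕜 A) (fun a b => by
      ext f
      simp [BanachBimodule.dual, BanachBimodule.dualLeftModule])
  -- Only the right action on the bidual survives, and it enters `a.E - E.a` with a minus sign.
  refine ⟨-E, fun a φ => ?_⟩
  have := DFunLike.congr_fun (hE a) φ
  simpa [BanachBimodule.dual, BanachBimodule.dualLeftModule] using this.symm

theorem IsAmenableBanachAlgebra.hasBoundedApproximateIdentity
    (hA : IsAmenableBanachAlgebra 𝕜 A) : HasBoundedApproximateIdentity A := by
  obtain ⟨R, hR⟩ := hA.exists_bidual_right_identity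
  obtain ⟨L, hL⟩ := hA.exists_bidual_left_identity
  set r := ‖R‖ + 1
  set l := ‖L‖ + 1
  have hr : 0 < r := by positivity
  have hl : 0 < l := by positivity
  refine hasBoundedApproximateIdentity_of_forall_finset (l + r + r * l) fun F ε hε => ?_
  obtain ⟨f, hf, hf'⟩ := exists_bounded_approx_of_bidual
    (fun a => ContinuousLinearMap.mul 𝕜 A a) R hR F (ε := ε / (1 + l)) (by positivity)
  obtain ⟨e, he, he'⟩ := exists_bounded_approx_of_bidual
    (fun a => (ContinuousLinearMap.mul 𝕜 A).flip a) L hL F (ε := ε / (1 + r)) (by positivity)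
  simp only [mul_apply', flip_apply] at hf' he'
  -- Formally `1 - (e + f - f * e) = (1 - f) * (1 - e)`, so the errors are `(a - a * f) * (1 - e)`
  -- and `(1 - f) * (a - e * a)`; hence the tolerances above.
  refine ⟨e + f - f * e, ?_, fun a ha => ⟨?_, ?_⟩⟩
  · refine (norm_sub_le _ _).trans (add_le_add ((norm_add_le _ _).trans (add_le_add he hf)) ?_)
    exact (norm_mul_le _ _).trans (mul_le_mul hf he (norm_nonneg _) hr.le)
  · have h1 : a * (e + f - f * e) - a = (a * f - a) - (a * f - a) * e := by noncomm_ring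
    rw [h1]
    have h2 := (norm_mul_le (a * f - a) e).trans
      (mul_le_mul_of_nonneg_left he (norm_nonneg _))
    have h3 := (lt_div_iff₀ (by positivity)).1 (hf' a ha)
    refine (norm_sub_le _ _).trans_lt ?_
    linarith
  · have h1 : (e + f - f * e) * a - a = (e * a - a) - f * (e * a - a) := by noncomm_ring
    rw [h1]
    have h2 := (norm_mul_le f (e * a - a)).trans
      (mul_le_mul_of_nonneg_right hf (norm_nonneg _))
    have h3 := (lt_div_iff₀ (by positivity)).1 (he' a ha)
    refine (norm_sub_le _ _).trans_lt ?_
    linarith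

end BoundedApproximateIdentity

/-! ### Mixed identities, and virtual diagonals from amenability. -/

section VirtualDiagonal

variable {𝕜 : Type} [RCLike 𝕜] {A : Type u} [NonUnitalNormedRing A] [NormedSpace 𝕜 A]

/-- A mixed identity of the bidual: `e` is at the same time a weak limit of left and of right
multiplications approximating the identity. -/
structure IsMixedIdentity (e : StrongDual 𝕜 (StrongDual 𝕜 A)) : Prop where
  left : ∀ (a : A) (φ ψ : StrongDual 𝕜 A), (∀ w, ψ w = φ (a * w)) → e ψ = φ a
  right : ∀ (a : A) (φ ψ : StrongDual 𝕜 A), (∀ w, ψ w = φ (w * a)) → e ψ = φ a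

/-- A virtual diagonal of `A`, as a functional on the bounded bilinear forms on `A`:
`a.M = M.a`, and the image of `M` under multiplication is `e`. -/
structure IsVirtualDiagonal (e : StrongDual 𝕜 (StrongDual 𝕜 A))
    (M : StrongDual 𝕜 (A →L[𝕜] A →L[𝕜] 𝕜)) : Prop where
  comm : ∀ (a : A) (F G H : A →L[𝕜] A →L[𝕜] 𝕜), (∀ u v, G u v = F (a * u) v) →
    (∀ u v, H u v = F u (v * a)) → M G = M H
  mul : ∀ (φ : StrongDual 𝕜 A) (F : A →L[𝕜] A →L[𝕜] 𝕜), (∀ u v, F u v = φ (u * v)) → M F = e φ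

/-- Along an ultrafilter finer than `l`, every `φ` has a limit by compactness of scalar balls; these
limits form a bounded functional of `φ`. -/
theorem HasBoundedApproximateIdentity.exists_isMixedIdentity
    (hA : HasBoundedApproximateIdentity A) :
    ∃ e : StrongDual 𝕜 (StrongDual 𝕜 A), IsMixedIdentity e := by
  obtain ⟨l, hl, C, hC⟩ := hA
  have := hl.neBot
  let U := Ultrafilter.of l
  have hU : (U : Filter A).IsApproximateUnit := 
    { tendsto_mul_left := fun m => (hl.tendsto_mul_left m).mono_left (Ultrafilter.of_le l)
      tendsto_mul_right := fun m => (hl.tendsto_mul_right m).mono_left (Ultrafilter.of_le l) }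
  have hUC : ∀ᶠ e in (U : Filter A), ‖e‖ ≤ C := hC.filter_mono (Ultrafilter.of_le l)
  have hlim : ∀ φ : StrongDual 𝕜 A, ∃ z ∈ Metric.closedBall (0 : 𝕜) (C * ‖φ‖),
      Tendsto φ U (𝓝 z) := by
    intro φ
    refine (isCompact_closedBall (0 : 𝕜) (C * ‖φ‖)).ultrafilter_le_nhds (U.map φ) ?_
    refine le_principal_iff.2 (hUC.mono fun e he => ?_)
    rw [mem_closedBall_zero_iff, mul_comm]
    exact φ.le_opNorm_of_le he
  choose L hLC hL using hlim
  let e : StrongDual 𝕜 (StrongDual 𝕜 A) := LinearMap.mkContinuous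
    { toFun := L
      map_add' := fun φ ψ => tendsto_nhds_unique (hL (φ + ψ)) ((hL φ).add (hL ψ))
      map_smul' := fun c φ => tendsto_nhds_unique (hL (c • φ)) ((hL φ).const_smul c) }
    C fun φ => by simpa using hLC φ
  refine ⟨e, fun a φ ψ h => ?_, fun a φ ψ h => ?_⟩
  · refine tendsto_nhds_unique (hL ψ) ?_
    simpa only [← h, Function.comp_def] using
      ((φ.continuous.tendsto a).comp (hU.tendsto_mul_left a))
  · refine tendsto_nhds_unique (hL ψ) ?_
    simpa only [← h, Function.comp_def] using
      ((φ.continuous.tendsto a).comp (hU.tendsto_mul_right a))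

/-- A bounded family of operators vanishing on a closed subspace descends to the quotient. -/
theorem exists_quotient_lift {X : Type u} {Y : Type v} [NormedAddCommGroup X] [NormedSpace 𝕜 X]
    [NormedAddCommGroup Y] [NormedSpace 𝕜 Y]
    (S : Submodule 𝕜 X) [IsClosed (S : Set X)] (D : A →L[𝕜] X →L[𝕜] Y)
    (hD : ∀ a, ∀ x ∈ S, D a x = 0) :
    ∃ D' : A →L[𝕜] (X ⧸ S) →L[𝕜] Y, ∀ a x, D' a (S.mkQL x) = D a x := by
  let f : A →ₗ[𝕜] (X ⧸ S) →ₗ[𝕜] Y :=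
    { toFun := fun a => S.liftQ (D a).toLinearMap (hD a)
      map_add' := fun a b => Submodule.linearMap_qext _ <| LinearMap.ext fun x =>
        congrArg (fun T : X →L[𝕜] Y => T x) (map_add D a b)
      map_smul' := fun c a => Submodule.linearMap_qext _ <| LinearMap.ext fun x =>
        congrArg (fun T : X →L[𝕜] Y => T x) (map_smul D c a) }
  refine ⟨f.mkContinuous₂ ‖D‖ fun a q => ?_, fun a x => rfl⟩
  refine le_of_forall_pos_le_add fun ε hε => ?_
  set K := ‖D‖ * ‖a‖ with hK
  have hK0 : 0 ≤ K := by positivity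
  obtain ⟨x, rfl, hx⟩ := Submodule.Quotient.norm_mk_lt q
    (show 0 < ε / (K + 1) by positivity)
  refine (D.le_opNorm₂ a x).trans ?_
  have h1 := (mul_le_mul_of_nonneg_left hx.le hK0)
  have h2 : K * (ε / (K + 1)) ≤ ε := by
    rw [mul_div_assoc', div_le_iff₀ (by positivity)]
    nlinarith
  linarith [mul_add K ‖(Submodule.Quotient.mk x : X ⧸ S)‖ (ε / (K + 1))]

/-- A bounded family of operators preserving a closed subspace descends to the quotient. -/
theorem exists_quotient_action {X : Type u} [NormedAddCommGroup X] [NormedSpace 𝕜 X]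
    (S : Submodule 𝕜 X) [IsClosed (S : Set X)] (L : A →L[𝕜] X →L[𝕜] X)
    (hL : ∀ a, ∀ x ∈ S, L a x ∈ S) :
    ∃ L' : A →L[𝕜] (X ⧸ S) →L[𝕜] (X ⧸ S), ∀ a x, L' a (S.mkQL x) = S.mkQL (L a x) :=
  exists_quotient_lift S (compL 𝕜 X X (X ⧸ S) S.mkQL ∘L L) fun a x hx =>
    (Submodule.Quotient.mk_eq_zero S).2 (hL a x hx)

/-- If `A` is amenable and the inner derivation of `X*` at `f` annihilates a closed submodule `S`
of `X`, then some central functional agrees with `f` on `S`. -/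
theorem exists_inner_vanishing_of_isAmenable (hA : IsAmenableBanachAlgebra 𝕜 A)
    {X : Type u} [NormedAddCommGroup X] [NormedSpace 𝕜 X] [CompleteSpace X]
    (M : BanachBimodule 𝕜 A X) (S : Submodule 𝕜 X) [IsClosed (S : Set X)]
    (hl : ∀ a, ∀ x ∈ S, M.lact a x ∈ S) (hr : ∀ a, ∀ x ∈ S, M.ract a x ∈ S)
    (f : StrongDual 𝕜 X) (hf : ∀ a, ∀ x ∈ S, f (M.ract a x) = f (M.lact a x)) :
    ∃ g : StrongDual 𝕜 X, (∀ x ∈ S, g x = f x) ∧ ∀ a x, g (M.ract a x) = g (M.lact a x) := by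
  obtain ⟨L, hL⟩ := exists_quotient_action S M.lact hl
  obtain ⟨R, hR⟩ := exists_quotient_action S M.ract hr
  have hsurj : ∀ q : X ⧸ S, ∃ x, S.mkQL x = q := S.mkQ_surjective
  let N : BanachBimodule 𝕜 A (X ⧸ S) :=
    { lact := L
      ract := R
      lact_mul := fun a b q => by
        obtain ⟨x, rfl⟩ := hsurj q
        simp only [hL, M.lact_mul]
      ract_mul := fun a b q => by
        obtain ⟨x, rfl⟩ := hsurj q
        simp only [hR, M.ract_mul]
      lact_ract := fun a b q => by
        obtain ⟨x, rfl⟩ := hsurj q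
        simp only [hL, hR, M.lact_ract] }
  -- The inner derivation at `f` takes values in `(X ⧸ S)*`, so it has a primitive `g` there; `f - g
  -- ∘L S.mkQL` is the central functional.
  obtain ⟨D, hD⟩ := exists_quotient_lift S (M.dual.lact.flip f - M.dual.ract.flip f)
    (fun a x hx => by
      simp [BanachBimodule.dual_lact_apply, BanachBimodule.dual_ract_apply, hf a x hx])
  have hD' : ∀ a x, D a (S.mkQL x) = f (M.ract a x) - f (M.lact a x) := fun a x => by
    rw [hD]; rfl
  obtain ⟨g, hg⟩ := exists_inner_of_isAmenable hA N D (fun a b => by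
    ext q
    obtain ⟨x, rfl⟩ := hsurj q
    simp only [_root_.add_apply, BanachBimodule.dual_lact_apply, BanachBimodule.dual_ract_apply,
      N, hL, hR, hD', M.lact_mul, M.ract_mul, M.lact_ract]
    ring)
  refine ⟨f - g ∘L S.mkQL, fun x hx => ?_, fun a x => ?_⟩
  · have : S.mkQL x = 0 := (Submodule.Quotient.mk_eq_zero S).2 hx
    rw [_root_.sub_apply, comp_apply, this, map_zero, sub_zero]
  · have h := DFunLike.congr_fun (hg a) (S.mkQL x)
    simp only [_root_.sub_apply, BanachBimodule.dual_lact_apply,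
      BanachBimodule.dual_ract_apply, N, hL, hR, hD'] at h
    simp only [_root_.sub_apply, comp_apply]
    linear_combination h

variable [IsScalarTower 𝕜 A A] [SMulCommClass 𝕜 A A]

variable (𝕜 A) in
/-- The bimodule of bounded bilinear forms: `(b.F)(u, v) = F(u, vb)`, `(F.b)(u, v) = F(bu, v)`. -/
noncomputable def BanachBimodule.bilinearForms :
    BanachBimodule 𝕜 A (A →L[𝕜] A →L[𝕜] 𝕜) where
  lact := compL 𝕜 A (A →L[𝕜] 𝕜) (A →L[𝕜] 𝕜) ∘L
    (compL 𝕜 A A 𝕜).flip ∘L (ContinuousLinearMap.mul 𝕜 A).flip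
  ract := (compL 𝕜 A A (A →L[𝕜] 𝕜)).flip ∘L ContinuousLinearMap.mul 𝕜 A
  lact_mul a b F := by ext u v; simp [mul_assoc]
  ract_mul a b F := by ext u v; simp [mul_assoc]
  lact_ract a b F := by ext u v; simp

theorem BanachBimodule.bilinearForms_lact_apply (b : A) (F : A →L[𝕜] A →L[𝕜] 𝕜) (u v : A) :
    (BanachBimodule.bilinearForms 𝕜 A).lact b F u v = F u (v * b) := rfl

theorem BanachBimodule.bilinearForms_ract_apply (b : A) (F : A →L[𝕜] A →L[𝕜] 𝕜) (u v : A) :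
    (BanachBimodule.bilinearForms 𝕜 A).ract b F u v = F (b * u) v := rfl

variable (𝕜 A) in
/-- The bounded bilinear forms `F` with `F(uv, w) = F(u, vw)`. -/
def balancedForms : Submodule 𝕜 (A →L[𝕜] A →L[𝕜] 𝕜) where
  carrier := {F | ∀ u v w, F (u * v) w = F u (v * w)}
  add_mem' hF hG u v w := by simp only [_root_.add_apply, hF u v w, hG u v w]
  zero_mem' _ _ _ := rfl
  smul_mem' c F hF u v w := by simp only [_root_.smul_apply, hF u v w]

omit [IsScalarTower 𝕜 A A] [SMulCommClass 𝕜 A A] in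
theorem isClosed_balancedForms : IsClosed (balancedForms 𝕜 A : Set (A →L[𝕜] A →L[𝕜] 𝕜)) := by
  have : (balancedForms 𝕜 A : Set (A →L[𝕜] A →L[𝕜] 𝕜)) =
      ⋂ u, ⋂ v, ⋂ w, {F | F (u * v) w = F u (v * w)} := by
    ext F; simp [balancedForms]
  rw [this]
  refine isClosed_iInter fun u => isClosed_iInter fun v => isClosed_iInter fun w =>
    isClosed_eq ?_ ?_ <;> fun_prop

-- With `w` running along `e`, `F(u, b) = lim F(u, bw) = lim F(ub, w)`; then `u` runs along `e`.
omit [IsScalarTower 𝕜 A A] [SMulCommClass 𝕜 A A] in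
theorem IsMixedIdentity.apply_balanced {e : StrongDual 𝕜 (StrongDual 𝕜 A)}
    (he : IsMixedIdentity e) {F : A →L[𝕜] A →L[𝕜] 𝕜} (hF : F ∈ balancedForms 𝕜 A) (b : A) :
    e (F.flip b) = e (F b) := by
  have h1 : ∀ u, F.flip b u = e (F (u * b)) := fun u =>
    (he.left b (F u) (F (u * b)) fun w => hF u b w).symm
  exact he.right b (e ∘L F) (F.flip b) h1

/-- The iterated limit `Φ`, playing the role of `e ⊗ e`, is central on balanced forms. It can be
made central everywhere without changing it there, and the forms `φ(uv)` are balanced. -/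
theorem IsAmenableBanachAlgebra.exists_isVirtualDiagonal (hA : IsAmenableBanachAlgebra 𝕜 A)
    {e : StrongDual 𝕜 (StrongDual 𝕜 A)} (he : IsMixedIdentity e) :
    ∃ M : StrongDual 𝕜 (A →L[𝕜] A →L[𝕜] 𝕜), IsVirtualDiagonal e M := by
  let Φ : StrongDual 𝕜 (A →L[𝕜] A →L[𝕜] 𝕜) := e ∘L compL 𝕜 A (A →L[𝕜] 𝕜) 𝕜 e
  have hΦ : ∀ F, Φ F = e (e ∘L F) := fun _ => rfl
  have : IsClosed (balancedForms 𝕜 A : Set (A →L[𝕜] A →L[𝕜] 𝕜)) := isClosed_balancedForms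
  obtain ⟨N, hN, hN'⟩ := exists_inner_vanishing_of_isAmenable hA
    (BanachBimodule.bilinearForms 𝕜 A) (balancedForms 𝕜 A)
    (fun a F hF u v w => by
      simp only [BanachBimodule.bilinearForms_lact_apply, hF u v, mul_assoc])
    (fun a F hF u v w => by
      simp only [BanachBimodule.bilinearForms_ract_apply, ← mul_assoc, hF (a * u) v])
    Φ (fun a F hF => by
      rw [hΦ, hΦ]
      rw [he.left a (e ∘L F) _ fun w => rfl]
      have h : e ∘L (BanachBimodule.bilinearForms 𝕜 A).lact a F = F.flip a := by
        ext u
        exact he.right a (F u) _ fun w => rfl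
      rw [h, he.apply_balanced hF, comp_apply])
  refine ⟨N, ⟨fun a F G H hG hH => ?_, fun φ F hF => ?_⟩⟩
  · have h1 : G = (BanachBimodule.bilinearForms 𝕜 A).ract a F := by ext u v; exact hG u v
    have h2 : H = (BanachBimodule.bilinearForms 𝕜 A).lact a F := by ext u v; exact hH u v
    rw [h1, h2, hN' a F]
  · have hmem : F ∈ balancedForms 𝕜 A := fun u v w => by rw [hF, hF, mul_assoc]
    have h : e ∘L F = φ := by
      ext u
      exact he.left u φ (F u) (hF u)
    rw [hN F hmem, hΦ, h]

end VirtualDiagonal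

/-! ### Amenability from a virtual diagonal. -/

section Amenability

variable {𝕜 : Type} [RCLike 𝕜] {A : Type u} [NonUnitalNormedRing A] [NormedSpace 𝕜 A]

/-- A Banach algebra with a mixed identity and a virtual diagonal is amenable. -/
theorem IsVirtualDiagonal.isAmenable {e : StrongDual 𝕜 (StrongDual 𝕜 A)}
    {M : StrongDual 𝕜 (A →L[𝕜] A →L[𝕜] 𝕜)} (hM : IsVirtualDiagonal e M)
    (he : IsMixedIdentity e) : IsAmenableBanachAlgebra 𝕜 A := by
  intro X _ _ _ N
  refine Submodule.Quotient.subsingleton_iff.2 (eq_top_iff.2 ?_)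
  rintro ⟨D, hD⟩ -
  replace hD : ∀ (a b : A) (x : X), D (a * b) x = D b (N.ract a x) + D a (N.lact b x) :=
    fun a b x => DFunLike.congr_fun (hD a b) x
  let K : X →L[𝕜] A →L[𝕜] A →L[𝕜] 𝕜 := compL 𝕜 A X (A →L[𝕜] 𝕜) D.flip ∘L N.ract.flip
  have hK : ∀ x s t, K x s t = D t (N.ract s x) := fun _ _ _ => rfl
  -- `P` is the left action of `e` on `X*`; it is needed because `X` need not be essential.
  -- Averaging by `M` gives a primitive `f` of `P ∘L D`. The remainder `D'` satisfies `a.D'(b) = 0`,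
  -- and its limit `g` along `e` has `g.a = D'(a)` and `a.g = 0`.
  let P : StrongDual 𝕜 X →L[𝕜] StrongDual 𝕜 X :=
    (compL 𝕜 X (A →L[𝕜] X) 𝕜).flip N.ract.flip ∘L
      compL 𝕜 (A →L[𝕜] X) (A →L[𝕜] 𝕜) 𝕜 e ∘L compL 𝕜 A X 𝕜
  have hP : ∀ φ x, P φ x = e (φ ∘L N.ract.flip x) := fun _ _ => rfl
  let D' : A →L[𝕜] StrongDual 𝕜 X := D - P ∘L D
  have hD' : ∀ a x, D' a x = D a x - P (D a) x := fun _ _ => rfl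
  have hPr : ∀ φ w x, P φ (N.ract w x) = φ (N.ract w x) := fun φ w x =>
    he.left w (φ ∘L N.ract.flip x) _ fun r => congrArg φ (N.ract_mul w r x).symm
  let f : StrongDual 𝕜 X := M ∘L K
  let g : StrongDual 𝕜 X := e ∘L D'.flip
  have hf : ∀ a x, f (N.ract a x) = P (D a) x + f (N.lact a x) := by
    intro a x
    let H : A →L[𝕜] A →L[𝕜] 𝕜 := compL 𝕜 A X 𝕜 (D a) ∘L N.ract.flip ∘L N.ract.flip x
    have h1 : M (K (N.ract a x)) = M (H + K (N.lact a x)) :=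
      hM.comm a (K x) _ _ (fun s t => by rw [hK, hK, N.ract_mul]) fun s t => by
        change D a (N.ract t (N.ract s x)) + D t (N.ract s (N.lact a x)) = _
        rw [hK, hD, N.lact_ract]
    have h2 : M H = e (D a ∘L N.ract.flip x) :=
      hM.mul _ _ fun s t => congrArg (D a) (N.ract_mul s t x).symm
    change M (K (N.ract a x)) = e (D a ∘L N.ract.flip x) + M (K (N.lact a x))
    rw [h1, map_add, h2]
  have hDmul : ∀ w b x, D' (w * b) x = D' w (N.lact b x) := by
    intro w b x
    have h1 : P (D (w * b)) x = D b (N.ract w x) + P (D w) (N.lact b x) := by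
      let φ : StrongDual 𝕜 A := D b ∘L N.ract w ∘L N.ract.flip x
      have hφ : e φ = D b (N.ract w x) :=
        he.right w (D b ∘L N.ract.flip x) φ fun s => congrArg (D b) (N.ract_mul s w x).symm
      have h2 : D (w * b) ∘L N.ract.flip x = φ + D w ∘L N.ract.flip (N.lact b x) := by
        ext s
        change D (w * b) (N.ract s x) = D b (N.ract w (N.ract s x)) + D w (N.ract s (N.lact b x))
        rw [hD, N.lact_ract]
      rw [hP, hP, h2, map_add, hφ]
    rw [hD', hD', h1, hD]
    ring
  have hgl : ∀ a x, g (N.lact a x) = D' a x := fun a x =>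
    he.right a (D'.flip x) _ fun w => (hDmul w a x).symm
  have hgr : ∀ a x, g (N.ract a x) = 0 := by
    intro a x
    have : D'.flip (N.ract a x) = 0 := by
      ext w
      change D' w (N.ract a x) = 0
      rw [hD', hPr, sub_self]
    change e (D'.flip (N.ract a x)) = 0
    rw [this, map_zero]
  refine ⟨f - g, fun a => ?_⟩
  ext x
  change D a x = (f (N.ract a x) - g (N.ract a x)) - (f (N.lact a x) - g (N.lact a x))
  rw [hf, hgr, hgl, hD']
  ring

end Amenability

/-! ### Passing a virtual diagonal to an ideal. -/

section Ideal

variable {𝕜 : Type} [RCLike 𝕜] {B : Type u} [NonUnitalNormedRing B] [NormedSpace 𝕜 B]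
  [IsScalarTower 𝕜 B B] [SMulCommClass 𝕜 B B] (A : NonUnitalSubalgebra 𝕜 B)

theorem NonUnitalSubalgebra.exists_mul_right_clm (hA : ∀ a ∈ A, ∀ b : B, a * b ∈ A) :
    ∃ j : A →L[𝕜] B →L[𝕜] A, ∀ a b, (j a b : B) = a * b :=
  ⟨(LinearMap.mk₂ 𝕜 (fun (a : A) (b : B) => (⟨a * b, hA a a.2 b⟩ : A))
    (fun _ _ _ => Subtype.ext (add_mul _ _ _)) (fun _ _ _ => Subtype.ext (smul_mul_assoc _ _ _))
    (fun _ _ _ => Subtype.ext (mul_add _ _ _))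
    (fun _ _ _ => Subtype.ext (mul_smul_comm _ _ _))).mkContinuous₂ 1
      fun a b => by rw [one_mul]; exact norm_mul_le (a : B) b, fun _ _ => rfl⟩

theorem NonUnitalSubalgebra.exists_mul_left_clm (hA : ∀ b : B, ∀ a ∈ A, b * a ∈ A) :
    ∃ j : A →L[𝕜] B →L[𝕜] A, ∀ a b, (j a b : B) = b * a :=
  ⟨(LinearMap.mk₂ 𝕜 (fun (a : A) (b : B) => (⟨b * a, hA b a a.2⟩ : A))
    (fun _ _ _ => Subtype.ext (mul_add _ _ _)) (fun _ _ _ => Subtype.ext (mul_smul_comm _ _ _))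
    (fun _ _ _ => Subtype.ext (add_mul _ _ _))
    (fun _ _ _ => Subtype.ext (smul_mul_assoc _ _ _))).mkContinuous₂ 1
      fun a b => by
        rw [one_mul, mul_comm]; exact norm_mul_le b (a : B), fun _ _ => rfl⟩

/-- For a functional `M` on `U →L T`, the map `F ↦ M (l q ∘ F ∘ r p)` is bounded and linear
in `F`, `p` and `q`. -/
theorem exists_pullback_functional {𝕜 : Type*} [RCLike 𝕜] {X Z P Q U T : Type*}
    [NormedAddCommGroup X] [NormedSpace 𝕜 X] [NormedAddCommGroup Z] [NormedSpace 𝕜 Z]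
    [NormedAddCommGroup P] [NormedSpace 𝕜 P] [NormedAddCommGroup Q] [NormedSpace 𝕜 Q]
    [NormedAddCommGroup U] [NormedSpace 𝕜 U] [NormedAddCommGroup T] [NormedSpace 𝕜 T]
    (r : P →L[𝕜] U →L[𝕜] X) (l : Q →L[𝕜] Z →L[𝕜] T) (M : StrongDual 𝕜 (U →L[𝕜] T)) :
    ∃ m : (X →L[𝕜] Z) →L[𝕜] P →L[𝕜] Q →L[𝕜] 𝕜,
      ∀ F p q, m F p q = M (l q ∘L F ∘L r p) := by
  let k : (U →L[𝕜] Z) →L[𝕜] Q →L[𝕜] 𝕜 :=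
    compL 𝕜 Q (U →L[𝕜] T) 𝕜 M ∘L
      (compL 𝕜 Q (Z →L[𝕜] T) (U →L[𝕜] T)).flip l ∘L (compL 𝕜 U Z T).flip
  exact ⟨compL 𝕜 P (U →L[𝕜] Z) (Q →L[𝕜] 𝕜) k ∘L
    (compL 𝕜 P (U →L[𝕜] X) (U →L[𝕜] Z)).flip r ∘L compL 𝕜 U X Z, fun _ _ _ => rfl⟩

/-- A virtual diagonal of `B` and a mixed identity of a two-sided ideal `A` of `B` yield a virtual
diagonal of `A`. -/
theorem IsVirtualDiagonal.exists_of_ideal (hl : ∀ b : B, ∀ a ∈ A, b * a ∈ A)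
    (hr : ∀ a ∈ A, ∀ b : B, a * b ∈ A)
    {E : StrongDual 𝕜 (StrongDual 𝕜 B)} {M : StrongDual 𝕜 (B →L[𝕜] B →L[𝕜] 𝕜)}
    (hM : IsVirtualDiagonal E M) (hE : IsMixedIdentity E)
    {e : StrongDual 𝕜 (StrongDual 𝕜 A)} (he : IsMixedIdentity e) :
    ∃ Ψ : StrongDual 𝕜 (A →L[𝕜] A →L[𝕜] 𝕜), IsVirtualDiagonal e Ψ := by
  obtain ⟨r, hr⟩ := A.exists_mul_right_clm hr
  obtain ⟨l, hl⟩ := A.exists_mul_left_clm hl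
  obtain ⟨m, hm⟩ := exists_pullback_functional (X := A) r ((compL 𝕜 B A 𝕜).flip ∘L l) M
  let W : (A →L[𝕜] A →L[𝕜] 𝕜) → A → A → B →L[𝕜] B →L[𝕜] 𝕜 := fun F p q =>
    (compL 𝕜 B A 𝕜).flip (l q) ∘L F ∘L r p
  have hW : ∀ F p q u v, W F p q u v = F (r p u) (l q v) := fun _ _ _ _ _ => rfl
  replace hm : ∀ F p q, m F p q = M (W F p q) := hm
  let Ψ : StrongDual 𝕜 (A →L[𝕜] A →L[𝕜] 𝕜) := e ∘L compL 𝕜 A (A →L[𝕜] 𝕜) 𝕜 e ∘L m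
  have hΨ : ∀ F, Ψ F = e (e ∘L m F) := fun _ => rfl
  refine ⟨Ψ, ⟨fun a F G H hG hH => ?_, fun φ F hF => ?_⟩⟩
  · have hmG : ∀ p, m G p = m F (a * p) := fun p => by
      ext q
      rw [hm, hm]
      congr 1
      ext u v
      rw [hW, hW, hG]
      congr 2
      exact Subtype.ext (by simp [hr, mul_assoc])
    have hmH : ∀ p q, m H p q = m F p (q * a) := fun p q => by
      rw [hm, hm]
      congr 1
      ext u v
      rw [hW, hW, hH]
      congr 1
      exact Subtype.ext (by simp [hl, mul_assoc])
    have hmF : ∀ p q, m F (p * a) q = m F p (a * q) := fun p q => by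
      rw [hm, hm]
      refine hM.comm a (W F p q) _ _ (fun u v => ?_) fun u v => ?_
      · rw [hW, hW]
        congr 2
        exact Subtype.ext (by simp [hr, mul_assoc])
      · rw [hW, hW]
        congr 1
        exact Subtype.ext (by simp [hl, mul_assoc])
    -- Both sides reduce to `e (m F a)`; on the right, `hmF` moves `a` across from `q` to `p`.
    rw [hΨ, hΨ, he.left a (e ∘L m F) (e ∘L m G) fun p => congrArg e (hmG p)]
    refine (he.right a (e ∘L m F) (e ∘L m H) fun p => ?_).symm
    exact (he.right a (m F p) (m H p) (hmH p)).trans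
      (he.left a (m F p) (m F (p * a)) (hmF p)).symm
  · have hmF : ∀ p s q, m F (p * s) q = φ (p * s * q) := fun p s q => by
      let θ : A → StrongDual 𝕜 B := fun c =>
        φ ∘L (ContinuousLinearMap.mul 𝕜 A).flip q ∘L r c
      have hθ : ∀ c w, θ c w = φ (r c w * q) := fun _ _ => rfl
      rw [hm, hM.mul (θ (p * s)) (W F (p * s) q) fun u v => ?_,
        hE.left s (θ p) (θ (p * s)) fun w => ?_, hθ]
      · congr 2
        exact Subtype.ext (by simp [hr])
      · rw [hθ, hθ]
        congr 2
        exact Subtype.ext (by simp [hr, mul_assoc])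
      · rw [hθ, hW, hF]
        congr 1
        exact Subtype.ext (by simp [hr, hl, mul_assoc])
    -- The auxiliary factor `s` is removed by letting it run along `e`.
    have hmF' : ∀ p q, m F p q = φ (p * q) := fun p q => by
      let ψ : StrongDual 𝕜 A := (m F).flip q ∘L ContinuousLinearMap.mul 𝕜 A p
      have h1 : e ψ = m F p q := he.left p ((m F).flip q) ψ fun _ => rfl
      rw [← h1]
      exact he.left p (φ ∘L (ContinuousLinearMap.mul 𝕜 A).flip q) ψ fun s => hmF p s q
    have h : e ∘L m F = φ := by
      ext p
      exact he.left p φ (m F p) (hmF' p)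
    rw [hΨ, h]

end Ideal

theorem theorem2p1 {𝕜 : Type} [RCLike 𝕜] {B : Type u} [NonUnitalNormedRing B]
    [NormedSpace 𝕜 B] [IsScalarTower 𝕜 B B] [SMulCommClass 𝕜 B B] [CompleteSpace B]
    (hB : IsAmenableBanachAlgebra 𝕜 B)
    (A : NonUnitalSubalgebra 𝕜 B) (hA_closed : IsClosed (A : Set B))
    (hA_left : ∀ b : B, ∀ a ∈ A, b * a ∈ A) (hA_right : ∀ a ∈ A, ∀ b : B, a * b ∈ A) :
    IsAmenableBanachAlgebra 𝕜 A ↔ HasBoundedApproximateIdentity A := by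
  refine ⟨fun hA => hA.hasBoundedApproximateIdentity, fun hA => ?_⟩
  obtain ⟨E, hE⟩ := hB.hasBoundedApproximateIdentity.exists_isMixedIdentity (𝕜 := 𝕜)
  obtain ⟨M, hM⟩ := hB.exists_isVirtualDiagonal hE
  obtain ⟨e, he⟩ := hA.exists_isMixedIdentity (𝕜 := 𝕜)
  obtain ⟨Ψ, hΨ⟩ := hM.exists_of_ideal A hA_left hA_right hE he
  exact hΨ.isAmenable he
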